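/- Let $\tau>0$ be such that $\sqrt{\tau/(1+\tau)}\notin\mathbb{Q}$ and let $T>2$. Consider the conservative system $$ \ddot\phi_1-\partial_x^2\phi_1+\partial_x\phi_2=0,\qquad \dot\phi_2-\partial_x\phi_3+\partial_x\dot\phi_1=0,\qquad \tau\dot\phi_3-\partial_x\phi_2=0\qquad\text{in }(0,1)\times(0,\infty), $$ with boundary conditions $\phi_i(0,t)=\phi_i(1,t)=0$ for $i=1,3$, $t>0$, and initial data $\phi_1(\cdot,0)=u_1^0$, $\dot\phi_1(\cdot,0)=u_1^1$, $\phi_2(\cdot,0)=u_2^0$, $\phi_3(\cdot,0)=u_3^0$ on $(0,1)$, all functions being complex valued. Set $$ \dot{\mathcal H}=\Big\{(u_1,u_2,u_3,u_4)\in H^1_0(0,1)\times L^2(0,1)\times L^2(0,1)\times L^2(0,1):\ \int_0^1u_3(x)\,dx=0\Big\}. $$ Then there is a constant $C>0$ (depending only on $\tau$ and $T$) such that for all $(u_1^0,u_1^1,u_2^0,u_3^0)\in\dot{\mathcal H}$ the solution $(\phi_1,\phi_2,\phi_3)$ of this system satisfies $$ \int_0^T\!\!\int_0^1|\phi_3(x,t)|^2\,dx\,dt\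 \ge\ C\,\big\|(u_1^0,u_1^1,u_2^0,u_3^0)\big\|^2_{H^1_0(0,1)\times L^2(0,1)\times L^2(0,1)\times L^2(0,1)} . $$ Here "solution" means the mild solution: $W=(\phi_1,\dot\phi_1,\phi_2,\phi_3)\in C([0,\infty);H^1_0\times L^2\times L^2\times L^2)$ such that $\int_0^tW\,ds\in D(\mathcal A)$ and $W(t)=W(0)+\mathcal A\int_0^tW\,ds$ for all $t\ge0$, where $\mathcal A(u_1,u_2,u_3,u_4)=\big(u_2,\ u_1''-u_3',\ u_4'-u_2',\ \tfrac1\tau u_3'\big)$ and $D(\mathcal A)=(H^2\cap H^1_0)\times H^1_0\times H^1\times H^1_0$. -/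

import Mathlib

open MeasureTheory Set
open scoped ContDiff

namespace Cattaneo

/-- The Lebesgue space `L²(0,1)` of complex valued functions. -/
abbrev L2 : Type := Lp ℂ 2 (volume.restrict (Ioo (0 : ℝ) 1))

/-- Test functions on the interval: smooth functions with compact support in `(0,1)`. -/
def IsTest (η : ℝ → ℂ) : Prop :=
  ContDiff ℝ ∞ η ∧ HasCompactSupport η ∧ tsupport η ⊆ Ioo (0 : ℝ) 1

/-- `g ∈ L²(0,1)` is the weak derivative of `u ∈ L²(0,1)`; in particular `u ∈ H¹(0,1)`. -/
def HasWeakDeriv (u g : L2) : Prop :=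
  ∀ η : ℝ → ℂ, IsTest η →
    ∫ x in Ioo (0 : ℝ) 1, u x * deriv η x = -∫ x in Ioo (0 : ℝ) 1, g x * η x

/-- The pairs `(η, η')`, for `η` a test function on `(0,1)`, in `L² × L²` with the norm
`(‖u‖² + ‖g‖²)^(1/2)`, which on such pairs is the norm of `H¹(0,1)`. -/
def testPairs : Submodule ℂ (WithLp 2 (L2 × L2)) where
  carrier := {p | ∃ η : ℝ → ℂ, IsTest η ∧
    (p.fst =ᵐ[volume.restrict (Ioo (0 : ℝ) 1)] η) ∧
    (p.snd =ᵐ[volume.restrict (Ioo (0 : ℝ) 1)] deriv η)}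
  add_mem' := by
    rintro p q ⟨η, ⟨h1, h2, h3⟩, h4, h5⟩ ⟨θ, ⟨k1, k2, k3⟩, k4, k5⟩
    refine ⟨η + θ, ⟨h1.add k1, h2.add k2,
      (tsupport_add η θ).trans (union_subset h3 k3)⟩, ?_, ?_⟩
    · exact (Lp.coeFn_add p.fst q.fst).trans (h4.add k4)
    · refine (Lp.coeFn_add p.snd q.snd).trans ((h5.add k5).trans (Filter.Eventually.of_forall ?_))
      intro x
      exact (deriv_add (h1.differentiable (by simp) x) (k1.differentiable (by simp) x)).symm
  zero_mem' := by
    refine ⟨0, ⟨contDiff_const, HasCompactSupport.zero, by simp⟩, ?_, ?_⟩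
    · exact Lp.coeFn_zero ℂ 2 _
    · refine (Lp.coeFn_zero ℂ 2 _).trans (Filter.Eventually.of_forall ?_)
      intro x
      simp
  smul_mem' := by
    rintro c p ⟨η, ⟨h1, h2, h3⟩, h4, h5⟩
    refine ⟨c • η, ⟨contDiff_const.smul h1, h2.smul_left (f := fun _ => c),
      (tsupport_smul_subset_right (fun _ => c) η).trans h3⟩, ?_, ?_⟩
    · exact (Lp.coeFn_smul c p.fst).trans (h4.const_smul c)
    · refine (Lp.coeFn_smul c p.snd).trans ((h5.const_smul c).trans
        (Filter.Eventually.of_forall ?_))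
      intro x
      exact (deriv_const_smul c (h1.differentiable (by simp) x)).symm

/-- The Sobolev space `H¹₀(0,1)`: the closure of the test functions in the `H¹` norm. An element
is stored as the pair `(u, u')`, and `‖(u, u')‖² = ‖u‖² + ‖u'‖²`. -/
abbrev H10 : Type := testPairs.topologicalClosure

/-- The underlying `L²` function of an element of `H¹₀(0,1)`. -/
def H10.fn (u : H10) : L2 := (u : WithLp 2 (L2 × L2)).fst

/-- The weak derivative of an element of `H¹₀(0,1)`. -/
def H10.dx (u : H10) : L2 := (u : WithLp 2 (L2 × L2)).snd

/-- The state space `H¹₀ × L² × L² × L²`, whose elements stand for `(φ₁, ∂ₜφ₁, φ₂, φ₃)`. -/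
abbrev State : Type := H10 × L2 × L2 × L2

/-- The square of the Hilbert norm of `H¹₀ × L² × L² × L²`. -/
noncomputable def State.normSq (U : State) : ℝ :=
  ‖U.1‖ ^ 2 + ‖U.2.1‖ ^ 2 + ‖U.2.2.1‖ ^ 2 + ‖U.2.2.2‖ ^ 2

/-- The graph of the generator of the conservative system:
`(u₁, u₂, u₃, u₄) ∈ (H² ∩ H¹₀) × H¹₀ × H¹ × H¹₀` and
`Z = (u₂, u₁'' - u₃', u₄' - u₂', u₃' / τ)`. -/
def IsGenerator (τ : ℝ) (U Z : State) : Prop :=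
  ∃ (d₁ : L2) (w : H10) (d₃ : L2) (q : H10),
    HasWeakDeriv U.1.dx d₁ ∧ w.fn = U.2.1 ∧ HasWeakDeriv U.2.2.1 d₃ ∧ q.fn = U.2.2.2 ∧
    Z.1 = w ∧ Z.2.1 = d₁ - d₃ ∧ Z.2.2.1 = q.dx - w.dx ∧ Z.2.2.2 = ((τ⁻¹ : ℝ) : ℂ) • d₃

/-- `W = (φ₁, ∂ₜφ₁, φ₂, φ₃)` is the (mild, i.e. semigroup) solution with initial data `U`: it is
continuous on `[0,∞)` with values in the state space and, for every `t ≥ 0`, the integral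
`∫₀ᵗ W` lies in the domain of the generator, which maps it to `W t - U`. -/
def IsSolution (τ : ℝ) (U : State) (W : ℝ → State) : Prop :=
  ContinuousOn W (Ici 0) ∧
    ∀ t : ℝ, 0 ≤ t → IsGenerator τ (∫ s in (0 : ℝ)..t, W s) (W t - U)

end Cattaneo

/-! Expand `∂ₓφ₁` and `φ₂` in cosines, `∂ₜφ₁` and `φ₃` in sines. The system then decouples: the
coefficients of the `n`-th mode solve `y' = nπ · modeOp τ y`, where the 4 × 4 operator `modeOp τ` is
the same for all modes (`IsGenerator.modeOf_eq`, `IsSolution.modeOf_eq`). Hence every mode follows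
one flow `modeFlow τ`, run at speed `nπ`.

That flow conserves `modeEnergy` and is observable through its last component: if `q` vanishes on an
interval, so do all the components. By compactness of the unit sphere, observation over a window of
length `πT` controls the energy (`exists_modeEnergy_le_modeObs`). In rescaled time, `[0, T]` becomes
`[0, nπT]`, that is `n` such windows, each holding the same energy; the factor `n` cancels the
Jacobian `1/(nπ)`, so the constant does not depend on `n` (`exists_modeEnergy_le_integral`).

At each fixed time the sines are orthogonal in `x`, so `‖φ₃‖²` is the sum of the squared modal
observations and no cross terms between modes have to be estimated. Summing the modal inequalities
by Parseval (`hasSum_sq_sin`, `hasSum_sq_cos`) gives the theorem. The mean of `φ₂` is the only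
coefficient of the zero mode that could escape observation, and it vanishes by assumption. -/

namespace Cattaneo

/-! ### Parseval for sines and cosines, by even and odd extension -/

/-- The extension of a function on `(0,1)` to `(-1,1)` with parity `σ`. -/
noncomputable def parityExt (σ : ℂ) (f : ℝ → ℂ) (x : ℝ) : ℂ := if 0 < x then f x else σ * f (-x)

theorem parityExt_comp_neg (σ : ℂ) (f : ℝ → ℂ) {x : ℝ} (hx : x ∈ Ioo (0 : ℝ) 1) :
    parityExt σ f (-x) = σ * f x := by
  have h : ¬ (0 < -x) := by linarith [hx.1]
  simp [parityExt, hx.1.le]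

theorem setIntegral_Ioo_neg_one_zero {E : Type*} [NormedAddCommGroup E] [NormedSpace ℝ E] 
    (g : ℝ → E) :
    ∫ x in Ioo (-1 : ℝ) 0, g x = ∫ x in Ioo (0 : ℝ) 1, g (-x) := by
  rw [← integral_Ioc_eq_integral_Ioo, ← integral_Ioc_eq_integral_Ioo,
    ← intervalIntegral.integral_of_le (by norm_num), ← intervalIntegral.integral_of_le (by norm_num),
    intervalIntegral.integral_comp_neg (f := g)]
  simp

theorem memLp_parityExt (σ : ℂ) {f : ℝ → ℂ} (hf : MemLp f 2 (volume.restrict (Ioo (0 : ℝ) 1))) :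
    MemLp (parityExt σ f) 2 (volume.restrict (Ioc (-1 : ℝ) 1)) := by
  have hm : MeasurePreserving (fun x : ℝ => -x) (volume.restrict (Ioo (-1 : ℝ) 0))
      (volume.restrict (Ioo (0 : ℝ) 1)) := by
    have := (Measure.measurePreserving_neg (volume : Measure ℝ)).restrict_preimage
      (measurableSet_Ioo (a := (0 : ℝ)) (b := 1))
    simpa using this
  have h1 : MemLp (parityExt σ f) 2 (volume.restrict (Ioo (0 : ℝ) 1)) := by
    refine hf.ae_eq ?_
    filter_upwards [ae_restrict_mem measurableSet_Ioo] with x hx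
    simp [parityExt, hx.1]
  have h2 : MemLp (parityExt σ f) 2 (volume.restrict (Ioo (-1 : ℝ) 0)) := by
    refine ((hf.comp_measurePreserving hm).const_mul σ).ae_eq ?_
    filter_upwards [ae_restrict_mem measurableSet_Ioo] with x hx
    simp [parityExt, not_lt.2 hx.2.le]
  have h3 : MemLp (parityExt σ f) 2
      (volume.restrict (Ioo (-1 : ℝ) 0) + volume.restrict (Ioo (0 : ℝ) 1)) := by
    refine ⟨h2.1.add_measure h1.1, ?_⟩
    have e2 := h2.2
    have e1 := h1.2
    rw [eLpNorm_lt_top_iff_lintegral_rpow_enorm_lt_top (by simp) (by simp)] at e1 e2 ⊢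
    rw [lintegral_add_measure]
    exact ENNReal.add_lt_top.2 ⟨e2, e1⟩
  have hd : Disjoint (Ioc (-1 : ℝ) 0) (Ioc (0 : ℝ) 1) := by
    rw [Set.disjoint_left]; intro x hx hy; linarith [hx.2, hy.1]
  rw [← Ioc_union_Ioc_eq_Ioc (b := (0 : ℝ)) (by norm_num) (by norm_num),
    Measure.restrict_union hd measurableSet_Ioc]
  rwa [← restrict_Ioo_eq_restrict_Ioc, ← restrict_Ioo_eq_restrict_Ioc]

theorem integral_neg_one_one_eq {E : Type*} [NormedAddCommGroup E] [NormedSpace ℝ E] 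
    {g : ℝ → E} (hg : IntegrableOn g (Ioc (-1 : ℝ) 1)) :
    ∫ x in (-1 : ℝ)..1, g x = ∫ x in Ioo (0 : ℝ) 1, (g x + g (-x)) := by
  have h1 : IntegrableOn g (Ioc (-1 : ℝ) 0) := hg.mono_set (Ioc_subset_Ioc_right (by norm_num))
  have h2 : IntegrableOn g (Ioc (0 : ℝ) 1) := hg.mono_set (Ioc_subset_Ioc_left (by norm_num))
  have h3 : IntegrableOn (fun x => g (-x)) (Ioo (0 : ℝ) 1) := by
    have hm := (Measure.measurePreserving_neg (volume : Measure ℝ)).restrict_preimage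
      (measurableSet_Ioo (a := (-1 : ℝ)) (b := 0))
    have := hm.integrable_comp_of_integrable (h1.mono_set Ioo_subset_Ioc_self)
    simpa [IntegrableOn, Function.comp_def] using this
  rw [← intervalIntegral.integral_add_adjacent_intervals (b := 0)
    ((intervalIntegrable_iff_integrableOn_Ioc_of_le (by norm_num)).2 h1)
    ((intervalIntegrable_iff_integrableOn_Ioc_of_le (by norm_num)).2 h2),
    intervalIntegral.integral_of_le (by norm_num), intervalIntegral.integral_of_le (by norm_num),
    integral_Ioc_eq_integral_Ioo, integral_Ioc_eq_integral_Ioo, setIntegral_Ioo_neg_one_zero,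
    integral_add (h2.mono_set Ioo_subset_Ioc_self) h3, add_comm]

/-- Folding `(-1,0)` onto `(0,1)` leaves `∫ f cos` for `σ = 1` and `-i ∫ f sin` for `σ = -1`. Over
the index set `ℤ`, with `n` and `-n` both counted, Parseval then needs no normalising factor. -/
theorem fourierCoeffOn_parityExt (σ : ℂ) {f : ℝ → ℂ}
    (hf : MemLp f 2 (volume.restrict (Ioo (0 : ℝ) 1))) (n : ℤ) :
    fourierCoeffOn (a := -1) (b := 1) (by norm_num) (parityExt σ f) n =
      (1 / 2) * ∫ x in Ioo (0 : ℝ) 1, f x * (Complex.exp (-(((n * Real.pi * x : ℝ) : ℂ) * Complex.I))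
        + σ * Complex.exp (((n * Real.pi * x : ℝ) : ℂ) * Complex.I)) := by
  have key : ∀ x : ℝ, (fourier (-n) (x : AddCircle (1 - (-1) : ℝ)) : ℂ) =
      Complex.exp (-(((n * Real.pi * x : ℝ) : ℂ) * Complex.I)) := by
    intro x
    rw [fourier_coe_apply]
    congr 1
    push_cast
    ring
  rw [fourierCoeffOn_eq_integral, integral_neg_one_one_eq]
  · have e : ((1 / (1 - -1 : ℝ)) : ℝ) = 1 / 2 := by norm_num
    rw [e, Complex.real_smul]
    congr 1
    · simp
    refine setIntegral_congr_fun measurableSet_Ioo fun x hx => ?_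
    simp only [smul_eq_mul]
    rw [parityExt_comp_neg σ f hx, key, key]
    simp only [parityExt, hx.1, if_true]
    have : -(((n * Real.pi * (-x) : ℝ) : ℂ) * Complex.I) =
      (((n * Real.pi * x : ℝ) : ℂ) * Complex.I) := by push_cast; ring
    rw [this]
    ring
  · have hI : IntegrableOn (parityExt σ f) (Ioc (-1 : ℝ) 1) :=
      (memLp_parityExt σ hf).integrable (by norm_num)
    refine hI.bdd_mul (c := 1) ?_ (Filter.Eventually.of_forall fun x => ?_)
    · exact (Continuous.aestronglyMeasurable (by fun_prop))
    · rw [key, ← neg_mul, ← Complex.ofReal_neg, Complex.norm_exp_ofReal_mul_I]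

theorem integral_norm_sq_parityExt {σ : ℂ} (hσ : ‖σ‖ = 1) {f : ℝ → ℂ}
    (hf : MemLp f 2 (volume.restrict (Ioo (0 : ℝ) 1))) :
    ∫ x in (-1 : ℝ)..1, ‖parityExt σ f x‖ ^ 2 = 2 * ∫ x in Ioo (0 : ℝ) 1, ‖f x‖ ^ 2 := by
  have hI : IntegrableOn (fun x => ‖parityExt σ f x‖ ^ 2) (Ioc (-1 : ℝ) 1) :=
    (memLp_parityExt σ hf).integrable_norm_pow (by norm_num)
  rw [integral_neg_one_one_eq hI, ← integral_const_mul]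
  refine setIntegral_congr_fun measurableSet_Ioo fun x hx => ?_
  rw [parityExt_comp_neg σ f hx, norm_mul, hσ]
  simp only [parityExt, hx.1, if_true]
  ring

/-- **Parseval's identity** for the cosine system on `(0,1)`, indexed by `ℤ`. -/
theorem hasSum_sq_cos {f : ℝ → ℂ} (hf : MemLp f 2 (volume.restrict (Ioo (0 : ℝ) 1))) :
    HasSum (fun n : ℤ => ‖∫ x in Ioo (0 : ℝ) 1, f x * (Real.cos (n * Real.pi * x) : ℂ)‖ ^ 2)
      (∫ x in Ioo (0 : ℝ) 1, ‖f x‖ ^ 2) := by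
  have h := hasSum_sq_fourierCoeffOn (a := -1) (b := 1) (by norm_num) (memLp_parityExt 1 hf)
  rw [integral_norm_sq_parityExt (by simp) hf] at h
  convert h using 1
  · funext n
    rw [fourierCoeffOn_parityExt 1 hf, ← integral_const_mul]
    congr 2
    refine integral_congr_ae (Filter.Eventually.of_forall fun x => ?_)
    simp only [Complex.ofReal_cos, Complex.cos]
    rw [← neg_mul]
    ring
  · rw [smul_eq_mul]; ring

/-- **Parseval's identity** for the sine system on `(0,1)`, indexed by `ℤ`. -/
theorem hasSum_sq_sin {f : ℝ → ℂ} (hf : MemLp f 2 (volume.restrict (Ioo (0 : ℝ) 1))) :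
    HasSum (fun n : ℤ => ‖∫ x in Ioo (0 : ℝ) 1, f x * (Real.sin (n * Real.pi * x) : ℂ)‖ ^ 2)
      (∫ x in Ioo (0 : ℝ) 1, ‖f x‖ ^ 2) := by
  have h := hasSum_sq_fourierCoeffOn (a := -1) (b := 1) (by norm_num) (memLp_parityExt (-1) hf)
  rw [integral_norm_sq_parityExt (by simp) hf] at h
  convert h using 1
  · funext n
    have e : ‖∫ x in Ioo (0 : ℝ) 1, f x * (Real.sin (n * Real.pi * x) : ℂ)‖ =
        ‖(-Complex.I) * ∫ x in Ioo (0 : ℝ) 1, f x * (Real.sin (n * Real.pi * x) : ℂ)‖ := by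
      simp
    rw [fourierCoeffOn_parityExt (-1) hf, e, ← integral_const_mul, ← integral_const_mul]
    congr 2
    refine integral_congr_ae (Filter.Eventually.of_forall fun x => ?_)
    simp only [Complex.ofReal_sin, Complex.sin]
    rw [← neg_mul]
    linear_combination (-(1 / 2) * f x * (Complex.exp (-((n * Real.pi * x : ℝ) : ℂ) * Complex.I) -
      Complex.exp (((n * Real.pi * x : ℝ) : ℂ) * Complex.I))) * Complex.I_sq
  · rw [smul_eq_mul]; ring

/-! ### The common ODE of the Fourier modes -/

/-- The coefficients `(v, p, θ, q)` of `(∂ₓφ₁, ∂ₜφ₁, φ₂, φ₃)` in one Fourier mode. -/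
abbrev Mode : Type := ℂ × ℂ × ℂ × ℂ

/-- The generator of the conservative system on a Fourier mode, divided by the wave number. -/
noncomputable def modeOp (τ : ℝ) : Mode →L[ℝ] Mode :=
  LinearMap.toContinuousLinearMap
    { toFun := fun y => (y.2.1, y.2.2.1 - y.1, y.2.2.2 - y.2.1, -(((τ⁻¹ : ℝ) : ℂ) * y.2.2.1))
      map_add' := fun x y => by
        ext <;> simp <;> ring
      map_smul' := fun c x => by
        ext <;> simp <;> ring }

theorem modeOp_apply (τ : ℝ) (y : Mode) : modeOp τ y =
    (y.2.1, y.2.2.1 - y.1, y.2.2.2 - y.2.1, -(((τ⁻¹ : ℝ) : ℂ) * y.2.2.1)) := rfl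

/-- The group generated by `modeOp`. -/
noncomputable def modeFlow (τ s : ℝ) : Mode →L[ℝ] Mode := NormedSpace.exp (s • modeOp τ)

theorem modeFlow_zero (τ : ℝ) : modeFlow τ 0 = 1 := by
  rw [modeFlow, zero_smul ℝ (modeOp τ), NormedSpace.exp_zero]

theorem modeFlow_add (τ s t : ℝ) (y : Mode) :
    modeFlow τ (s + t) y = modeFlow τ s (modeFlow τ t y) := by
  have h : modeFlow τ (s + t) = modeFlow τ s * modeFlow τ t := by
    let _ : NormedAlgebra ℚ (Mode →L[ℝ] Mode) := NormedAlgebra.restrictScalars ℚ ℝ _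
    have hc : Commute (s • modeOp τ) (t • modeOp τ) := ContinuousLinearMap.ext fun y => by
      change s • modeOp τ (t • modeOp τ y) = t • modeOp τ (s • modeOp τ y)
      rw [map_smul, map_smul, smul_comm]
    rw [modeFlow, add_smul s t (modeOp τ), NormedSpace.exp_add_of_commute hc]
    rfl
  rw [h]; rfl

theorem hasDerivAt_modeFlow (τ : ℝ) (y : Mode) (s : ℝ) :
    HasDerivAt (fun r => modeFlow τ r y) (modeOp τ (modeFlow τ s y)) s := by
  have h := hasDerivAt_exp_smul_const' (𝕂 := ℝ) (modeOp τ) s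
  exact h.clm_apply (hasDerivAt_const s y) |>.congr_deriv (by simp [modeFlow])

theorem continuous_modeFlow (τ : ℝ) : Continuous (modeFlow τ) := by
  refine continuous_iff_continuousAt.2 fun s => ?_
  exact (hasDerivAt_exp_smul_const' (𝕂 := ℝ) (modeOp τ) s).continuousAt

/-- The energy of a Fourier mode. -/
noncomputable def modeEnergy (τ : ℝ) (y : Mode) : ℝ :=
  ‖y.1‖ ^ 2 + ‖y.2.1‖ ^ 2 + ‖y.2.2.1‖ ^ 2 + τ * ‖y.2.2.2‖ ^ 2

/-- `modeOp τ` is skew-adjoint for the inner product with weight `τ` on the last component, so the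
energy has zero derivative. -/
theorem modeEnergy_modeFlow {τ : ℝ} (hτ : 0 < τ) (y : Mode) (s : ℝ) :
    modeEnergy τ (modeFlow τ s y) = modeEnergy τ y := by
  have hd : ∀ r, HasDerivAt (fun r => modeEnergy τ (modeFlow τ r y)) 0 r := by
    intro r
    have h := hasDerivAt_modeFlow τ y r
    have h1 : HasDerivAt (fun r => (modeFlow τ r y).1) (modeOp τ (modeFlow τ r y)).1 r := h.fst
    have h2 : HasDerivAt (fun r => (modeFlow τ r y).2.1) (modeOp τ (modeFlow τ r y)).2.1 r :=
      h.snd.fst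
    have h3 : HasDerivAt (fun r => (modeFlow τ r y).2.2.1) (modeOp τ (modeFlow τ r y)).2.2.1 r :=
      h.snd.snd.fst
    have h4 : HasDerivAt (fun r => (modeFlow τ r y).2.2.2) (modeOp τ (modeFlow τ r y)).2.2.2 r :=
      h.snd.snd.snd
    have e := ((h1.norm_sq.add h2.norm_sq).add h3.norm_sq).add (h4.norm_sq.const_mul τ)
    refine e.congr_deriv ?_
    simp only [modeOp_apply, Complex.inner]
    simp
    field_simp
    ring
  have := is_const_of_deriv_eq_zero (fun r => (hd r).differentiableAt) (fun r => (hd r).deriv) s 0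
  simpa [modeFlow_zero] using this

theorem eq_zero_of_modeEnergy_eq_zero {τ : ℝ} (hτ : 0 < τ) {y : Mode}
    (h : modeEnergy τ y = 0) : y = 0 := by
  unfold modeEnergy at h
  have h1 := sq_nonneg ‖y.1‖
  have h2 := sq_nonneg ‖y.2.1‖
  have h3 := sq_nonneg ‖y.2.2.1‖
  have h4 := mul_nonneg hτ.le (sq_nonneg ‖y.2.2.2‖)
  have e1 : ‖y.1‖ ^ 2 = 0 := by linarith
  have e2 : ‖y.2.1‖ ^ 2 = 0 := by linarith
  have e3 : ‖y.2.2.1‖ ^ 2 = 0 := by linarith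
  have e4 : τ * ‖y.2.2.2‖ ^ 2 = 0 := by linarith
  simp [hτ.ne'] at e1 e2 e3 e4
  ext1
  · exact e1
  · ext1
    · exact e2
    · ext1
      · exact e3
      · exact e4

theorem modeEnergy_le {τ : ℝ} (hτ : 0 < τ) (y : Mode) :
    modeEnergy τ y ≤ (3 + τ) * ‖y‖ ^ 2 := by
  have h1 : ‖y.1‖ ≤ ‖y‖ := norm_fst_le y
  have h0 : ‖y.2‖ ≤ ‖y‖ := norm_snd_le y
  have h2 : ‖y.2.1‖ ≤ ‖y‖ := (norm_fst_le y.2).trans h0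
  have h5 : ‖y.2.2‖ ≤ ‖y‖ := (norm_snd_le y.2).trans h0
  have h3 : ‖y.2.2.1‖ ≤ ‖y‖ := (norm_fst_le y.2.2).trans h5
  have h4 : ‖y.2.2.2‖ ≤ ‖y‖ := (norm_snd_le y.2.2).trans h5
  have : modeEnergy τ y ≤ ‖y‖ ^ 2 + ‖y‖ ^ 2 + ‖y‖ ^ 2 + τ * ‖y‖ ^ 2 := by
    unfold modeEnergy; gcongr
  linarith

/-! ### Observability of the mode ODE, uniform in the wave number -/

theorem HasDerivAt.eq_zero_of_eqOn_zero {E : Type*} [NormedAddCommGroup E] [NormedSpace ℝ E]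
    {f : ℝ → E} {f' : E} {s : Set ℝ} {x : ℝ} (hs : IsOpen s) (hx : x ∈ s)
    (h0 : ∀ y ∈ s, f y = 0) (h : HasDerivAt f f' x) : f' = 0 := by
  have : HasDerivAt f 0 x := by
    refine (hasDerivAt_const x (0 : E)).congr_of_eventuallyEq ?_
    filter_upwards [hs.mem_nhds hx] with y hy using h0 y hy
  exact h.unique this

/-- The time-integrated observation of the last component along the flow. -/
noncomputable def modeObs (τ L : ℝ) (y : Mode) : ℝ :=
  ∫ s in (0 : ℝ)..L, ‖(modeFlow τ s y).2.2.2‖ ^ 2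

theorem continuous_modeObs (τ L : ℝ) : Continuous (modeObs τ L) := by
  unfold modeObs
  refine intervalIntegral.continuous_parametric_intervalIntegral_of_continuous ?_ continuous_const
  have : Continuous (fun p : Mode × ℝ => modeFlow τ p.2 p.1) :=
    ((continuous_modeFlow τ).comp continuous_snd).clm_apply continuous_fst
  exact (this.snd.snd.snd.norm.pow 2)

theorem continuous_modeFlow_apply (τ : ℝ) (y : Mode) : Continuous fun s => modeFlow τ s y :=
  (continuous_modeFlow τ).clm_apply continuous_const

theorem modeObs_smul (τ L r : ℝ) (y : Mode) : modeObs τ L (r • y) = r ^ 2 * modeObs τ L y := by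
  simp [modeObs, mul_pow, ← intervalIntegral.integral_const_mul]

theorem modeObs_nonneg (τ : ℝ) {L : ℝ} (hL : 0 < L) (y : Mode) : 0 ≤ modeObs τ L y :=
  intervalIntegral.integral_nonneg hL.le fun _ _ => by positivity

/-- Unique continuation: a mode that is not observed vanishes. -/
theorem eq_zero_of_modeObs_eq_zero {τ L : ℝ} (hτ : 0 < τ) (hL : 0 < L) {y : Mode}
    (h : modeObs τ L y = 0) : y = 0 := by
  have hc : Continuous fun s => ‖(modeFlow τ s y).2.2.2‖ ^ 2 :=
    (continuous_modeFlow_apply τ y).snd.snd.snd.norm.pow 2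
  have hq : ∀ s ∈ Ioo 0 L, (modeFlow τ s y).2.2.2 = 0 := by
    intro s hs
    by_contra hne
    have : 0 < modeObs τ L y :=
      intervalIntegral.integral_pos hL hc.continuousOn (fun _ _ => by positivity)
        ⟨s, Ioo_subset_Icc_self hs, by positivity⟩
    exact this.ne' h
  -- The equations form a chain: `q = 0` forces `θ = 0` through `q'`, then `p = 0` through `θ' = q -
  -- p`, then `v = 0` through `p' = θ - v`.
  have hd := fun s => hasDerivAt_modeFlow τ y s
  simp only [modeOp_apply] at hd
  have hθ : ∀ s ∈ Ioo 0 L, (modeFlow τ s y).2.2.1 = 0 := fun s hs => by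
    have := HasDerivAt.eq_zero_of_eqOn_zero isOpen_Ioo hs hq (hd s).snd.snd.snd
    simpa [hτ.ne'] using this
  have hp : ∀ s ∈ Ioo 0 L, (modeFlow τ s y).2.1 = 0 := fun s hs => by
    have := HasDerivAt.eq_zero_of_eqOn_zero isOpen_Ioo hs hθ (hd s).snd.snd.fst
    simpa [hq s hs] using this
  have hv : ∀ s ∈ Ioo 0 L, (modeFlow τ s y).1 = 0 := fun s hs => by
    have := HasDerivAt.eq_zero_of_eqOn_zero isOpen_Ioo hs hp (hd s).snd.fst
    simpa [hθ s hs] using this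
  have hs : L / 2 ∈ Ioo 0 L := ⟨by linarith, by linarith⟩
  -- Energy conservation carries the vanishing from the interior time `L / 2` back to time `0`.
  refine eq_zero_of_modeEnergy_eq_zero hτ ?_
  rw [← modeEnergy_modeFlow hτ y (L / 2)]
  simp [modeEnergy, hq _ hs, hθ _ hs, hp _ hs, hv _ hs]

/-- The continuous function `modeObs` attains a minimum on the unit sphere, positive by unique
continuation; homogeneity of degree two extends the bound to all modes. The factor `3 + τ` compares
the energy with the sup norm of `Mode`. -/
theorem exists_modeEnergy_le_modeObs {τ L : ℝ} (hτ : 0 < τ) (hL : 0 < L) :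
    ∃ c : ℝ, 0 < c ∧ ∀ y : Mode, c * modeEnergy τ y ≤ modeObs τ L y := by
  obtain ⟨y₀, hy₀, hmin⟩ := (isCompact_sphere (0 : Mode) 1).exists_isMinOn
    (NormedSpace.sphere_nonempty.2 zero_le_one) (continuous_modeObs τ L).continuousOn
  have hpos : 0 < modeObs τ L y₀ := by
    refine lt_of_le_of_ne (modeObs_nonneg τ hL y₀) fun h => ?_
    have := eq_zero_of_modeObs_eq_zero hτ hL h.symm
    simp [this] at hy₀
  refine ⟨modeObs τ L y₀ / (3 + τ), by positivity, fun y => ?_⟩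
  have h1 : modeObs τ L y₀ * ‖y‖ ^ 2 ≤ modeObs τ L y := by
    by_cases hy : y = 0
    · simpa [hy] using modeObs_nonneg τ hL 0
    have hy' : ‖y‖ ≠ 0 := norm_ne_zero_iff.2 hy
    have hmem : ‖y‖⁻¹ • y ∈ Metric.sphere (0 : Mode) 1 := by
      simp [norm_smul, hy']
    have h2 : modeObs τ L y₀ ≤ modeObs τ L (‖y‖⁻¹ • y) := hmin hmem
    rw [modeObs_smul, inv_pow, inv_mul_eq_div, le_div_iff₀ (by positivity)] at h2
    exact h2
  have h3 := modeEnergy_le hτ y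
  rw [div_mul_eq_mul_div, div_le_iff₀ (by positivity)]
  nlinarith [mul_le_mul_of_nonneg_left h3 hpos.le]

/-- Observability of the modes, uniform in the wave number. -/
theorem exists_modeEnergy_le_integral {τ T : ℝ} (hτ : 0 < τ) (hT : 0 < T) :
    ∃ c : ℝ, 0 < c ∧ ∀ n : ℕ, 0 < n → ∀ y : Mode, c * modeEnergy τ y ≤
      ∫ t in (0 : ℝ)..T, ‖(modeFlow τ (n * Real.pi * t) y).2.2.2‖ ^ 2 := by
  obtain ⟨c, hc, h⟩ := exists_modeEnergy_le_modeObs hτ (L := Real.pi * T) (by positivity)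
  refine ⟨c / Real.pi, by positivity, fun n hn y => ?_⟩
  have hn' : (0 : ℝ) < n := by exact_mod_cast hn
  have hcont : Continuous fun s => ‖(modeFlow τ s y).2.2.2‖ ^ 2 :=
    (continuous_modeFlow_apply τ y).snd.snd.snd.norm.pow 2
  -- The rescaled interval is cut into `n` windows of length `πT`; the group property makes each one
  -- an observation started from a shifted state.
  have h1 : ∫ s in (0 : ℝ)..(n * Real.pi * T), ‖(modeFlow τ s y).2.2.2‖ ^ 2 =
      ∑ m ∈ Finset.range n, modeObs τ (Real.pi * T) (modeFlow τ (m * (Real.pi * T)) y) := by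
    have := intervalIntegral.sum_integral_adjacent_intervals (n := n) (μ := volume)
      (f := fun s => ‖(modeFlow τ s y).2.2.2‖ ^ 2) (a := fun m : ℕ => (m : ℝ) * (Real.pi * T))
      (fun k _ => hcont.intervalIntegrable _ _)
    simp only [Nat.cast_zero, zero_mul] at this
    rw [mul_assoc, ← this]
    refine Finset.sum_congr rfl fun m _ => ?_
    unfold modeObs
    simp_rw [← modeFlow_add]
    rw [intervalIntegral.integral_comp_add_right (fun s => ‖(modeFlow τ s y).2.2.2‖ ^ 2)]
    congr 1 <;> push_cast <;> ring
  have h2 : (n : ℝ) * (c * modeEnergy τ y) ≤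
      ∫ s in (0 : ℝ)..(n * Real.pi * T), ‖(modeFlow τ s y).2.2.2‖ ^ 2 := by
    rw [h1, ← nsmul_eq_mul, ← Finset.card_range n, ← Finset.sum_const, Finset.card_range]
    refine Finset.sum_le_sum fun m _ => ?_
    have := h (modeFlow τ (m * (Real.pi * T)) y)
    rwa [modeEnergy_modeFlow hτ] at this
  rw [intervalIntegral.integral_comp_mul_left (fun s => ‖(modeFlow τ s y).2.2.2‖ ^ 2)
    (by positivity), mul_zero, smul_eq_mul, inv_mul_eq_div, le_div_iff₀ (by positivity)]
  calc c / Real.pi * modeEnergy τ y * (n * Real.pi) = n * (c * modeEnergy τ y) := by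
        field_simp
    _ ≤ _ := h2

/-- A continuous solution of the integral equation is differentiable as a primitive, so uniqueness
for a Lipschitz ODE identifies it with the flow. -/
theorem eq_modeFlow_of_integral_eq {τ k : ℝ} {y : ℝ → Mode} (hy : ContinuousOn y (Ici 0))
    (h : ∀ t, 0 ≤ t → y t - y 0 = k • modeOp τ (∫ s in (0 : ℝ)..t, y s)) {t : ℝ} (ht : 0 ≤ t) :
    y t = modeFlow τ (k * t) (y 0) := by
  -- Freezing `y` at `y 0` for negative times makes the integrand continuous on all of `ℝ`, so the
  -- primitive has a two-sided derivative even at `0`.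
  set z : ℝ → Mode := fun t => y (max t 0) with hz
  have hzc : Continuous z := hy.comp_continuous (by fun_prop) fun t => le_max_right t 0
  set f : ℝ → Mode := fun t => y 0 + k • modeOp τ (∫ s in (0 : ℝ)..t, z s) with hf
  have hfz : ∀ t, 0 ≤ t → f t = y t := by
    intro t ht
    have : ∫ s in (0 : ℝ)..t, z s = ∫ s in (0 : ℝ)..t, y s := by
      refine intervalIntegral.integral_congr fun s hs => ?_
      rw [uIcc_of_le ht] at hs
      simp [hz, hs.1]
    rw [hf]; simp only
    rw [this, ← h t ht]; abel
  have hfd : ∀ t, HasDerivAt f (k • modeOp τ (z t)) t := by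
    intro t
    have h1 := intervalIntegral.integral_hasDerivAt_right (hzc.intervalIntegrable 0 t)
      (hzc.stronglyMeasurableAtFilter _ _) hzc.continuousAt
    have h2 := ((modeOp τ).hasFDerivAt.comp_hasDerivAt t h1).const_smul k
    simpa [hf] using h2.const_add (y 0)
  have hgd : ∀ t, HasDerivAt (fun t => modeFlow τ (k * t) (y 0))
      (k • modeOp τ (modeFlow τ (k * t) (y 0))) t := by
    intro t
    have h1 := (hasDerivAt_modeFlow τ (y 0) (k * t)).scomp t ((hasDerivAt_id t).const_mul k)
    simpa [Function.comp_def] using h1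
  have hu := ODE_solution_unique (v := fun _ => (k • modeOp τ)) (a := 0) (b := t)
    (K := ‖k • modeOp τ‖₊) (f := f) (g := fun t => modeFlow τ (k * t) (y 0))
    (fun _ => (k • modeOp τ).lipschitz)
    (fun s _ => (hfd s).continuousAt.continuousWithinAt)
    (fun s hs => by
      refine ((hfd s).congr_deriv ?_).hasDerivWithinAt
      rw [hfz s hs.1]; simp [hz, hs.1])
    (fun s _ => (hgd s).continuousAt.continuousWithinAt)
    (fun s hs => (hgd s).hasDerivWithinAt)
    (by simp [hf, modeFlow_zero])
  rw [← hfz t ht]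
  exact hu ⟨ht, le_rfl⟩

/-! ### Testing weak derivatives without compact support -/

theorem deriv_smoothTransition_of_notMem {x : ℝ} (hx : x ∉ Icc (0 : ℝ) 1) :
    deriv Real.smoothTransition x = 0 := by
  rcases lt_or_ge x 0 with h | h
  · have : Real.smoothTransition =ᶠ[nhds x] fun _ => 0 := by
      filter_upwards [Iio_mem_nhds h] with y hy using Real.smoothTransition.zero_of_nonpos (le_of_lt hy)
    rw [this.deriv_eq, deriv_const]
  · have h1 : 1 < x := by
      by_contra hle
      exact hx ⟨h, not_lt.1 hle⟩
    have : Real.smoothTransition =ᶠ[nhds x] fun _ => 1 := by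
      filter_upwards [Ioi_mem_nhds h1] with y hy using Real.smoothTransition.one_of_one_le (le_of_lt hy)
    rw [this.deriv_eq, deriv_const]

theorem exists_abs_deriv_smoothTransition_le :
    ∃ D : ℝ, 0 ≤ D ∧ ∀ x, |deriv Real.smoothTransition x| ≤ D := by
  have hc : Continuous (deriv Real.smoothTransition) :=
    (Real.smoothTransition.contDiff (n := 1)).continuous_deriv le_rfl
  obtain ⟨D, hD⟩ := isCompact_Icc.exists_bound_of_continuousOn (s := Icc (0 : ℝ) 1) hc.continuousOn
  refine ⟨D, (norm_nonneg _).trans (hD 0 (by simp)), fun x => ?_⟩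
  by_cases hx : x ∈ Icc (0 : ℝ) 1
  · exact hD x hx
  · rw [deriv_smoothTransition_of_notMem hx, abs_zero]
    exact (norm_nonneg _).trans (hD 0 (by simp))

/-- A smooth cutoff function which equals `1` at distance more than `2 / r` from the ends of
`(0,1)` and vanishes at distance less than `1 / r`. -/
noncomputable def cutoff (r x : ℝ) : ℝ :=
  Real.smoothTransition (r * x - 1) * Real.smoothTransition (r * (1 - x) - 1)

/-- The derivative of `cutoff`. -/
noncomputable def cutoffDeriv (r x : ℝ) : ℝ :=
  r * deriv Real.smoothTransition (r * x - 1) * Real.smoothTransition (r * (1 - x) - 1) -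
    Real.smoothTransition (r * x - 1) * (r * deriv Real.smoothTransition (r * (1 - x) - 1))

theorem hasDerivAt_cutoff (r x : ℝ) : HasDerivAt (cutoff r) (cutoffDeriv r x) x := by
  have hd : ∀ y, HasDerivAt Real.smoothTransition (deriv Real.smoothTransition y) y := fun y =>
    ((Real.smoothTransition.contDiff (n := 1)).differentiable (by simp) y).hasDerivAt
  have h1 : HasDerivAt (fun x : ℝ => r * x - 1) r x := by
    simpa using ((hasDerivAt_id x).const_mul r).sub_const 1
  have h2 : HasDerivAt (fun x : ℝ => r * (1 - x) - 1) (-r) x := by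
    simpa using (((hasDerivAt_id x).const_sub 1).const_mul r).sub_const 1
  have := ((hd _).comp x h1).mul ((hd _).comp x h2)
  refine this.congr_deriv ?_
  simp only [cutoffDeriv, Function.comp]
  ring

theorem contDiff_cutoff (r : ℝ) : ContDiff ℝ ∞ (cutoff r) := by
  unfold cutoff
  exact (Real.smoothTransition.contDiff.comp (by fun_prop)).mul
    (Real.smoothTransition.contDiff.comp (by fun_prop))

theorem abs_smoothTransition_le_one (x : ℝ) : |Real.smoothTransition x| ≤ 1 := by
  rw [abs_of_nonneg (Real.smoothTransition.nonneg x)]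
  exact Real.smoothTransition.le_one x

theorem abs_cutoff_le_one (r x : ℝ) : |cutoff r x| ≤ 1 := by
  rw [cutoff, abs_mul]
  exact mul_le_one₀ (abs_smoothTransition_le_one _) (abs_nonneg _) (abs_smoothTransition_le_one _)

theorem tsupport_cutoff_subset {r : ℝ} (hr : 0 < r) :
    tsupport (cutoff r) ⊆ Icc (1 / r) (1 - 1 / r) := by
  refine closure_minimal (fun x hx => ?_) isClosed_Icc
  have h1 : 0 < r * x - 1 := by
    by_contra h
    exact hx (by simp only [cutoff, Real.smoothTransition.zero_of_nonpos (not_lt.1 h), zero_mul])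
  have h2 : 0 < r * (1 - x) - 1 := by
    by_contra h
    exact hx (by simp only [cutoff, Real.smoothTransition.zero_of_nonpos (not_lt.1 h), mul_zero])
  constructor
  · rw [div_le_iff₀ hr]; linarith
  · rw [le_sub_comm, div_le_iff₀ hr]; linarith

theorem cutoff_eq_one {r x : ℝ} (h1 : 2 ≤ r * x) (h2 : 2 ≤ r * (1 - x)) : cutoff r x = 1 := by
  rw [cutoff, Real.smoothTransition.one_of_one_le (by linarith),
    Real.smoothTransition.one_of_one_le (by linarith), one_mul]

theorem cutoffDeriv_eq_zero {r x : ℝ} (h1 : 2 < r * x) (h2 : 2 < r * (1 - x)) :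
    cutoffDeriv r x = 0 := by
  rw [cutoffDeriv, deriv_smoothTransition_of_notMem, deriv_smoothTransition_of_notMem]
  · simp
  · intro h; linarith [h.2]
  · intro h; linarith [h.2]

/-- The derivative is nonzero only for `1 ≤ r * y ≤ 2`, where `|a| ≤ K * y ≤ 2 * K / r` absorbs the
factor `r`. This gives a bound independent of `r`. -/
theorem mul_abs_deriv_smoothTransition_mul_le {D K r y a : ℝ} (hr : 0 < r) (hK : 0 ≤ K)
    (hD : ∀ x, |deriv Real.smoothTransition x| ≤ D) (ha : |a| ≤ K * y) :
    r * |deriv Real.smoothTransition (r * y - 1)| * |a| ≤ 2 * D * K := by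
  have hD0 : 0 ≤ D := (abs_nonneg _).trans (hD 0)
  by_cases h : r * y - 1 ∈ Icc (0 : ℝ) 1
  · calc r * |deriv Real.smoothTransition (r * y - 1)| * |a| ≤ r * D * (K * y) := by
          gcongr
          exact hD _
      _ = D * K * (r * y) := by ring
      _ ≤ D * K * 2 := by
          have := h.2
          gcongr
          linarith
      _ = _ := by ring
  · rw [deriv_smoothTransition_of_notMem h]
    simp
    positivity

theorem abs_cutoffDeriv_mul_le {D K r x a : ℝ} (hr : 0 < r) (hK : 0 ≤ K)
    (hD : ∀ x, |deriv Real.smoothTransition x| ≤ D) (h0 : |a| ≤ K * x) (h1 : |a| ≤ K * (1 - x)) :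
    |cutoffDeriv r x * a| ≤ 4 * D * K := by
  have e1 := mul_abs_deriv_smoothTransition_mul_le hr hK hD h0
  have e2 := mul_abs_deriv_smoothTransition_mul_le hr hK hD h1
  rw [cutoffDeriv, sub_mul]
  refine (abs_sub _ _).trans ?_
  simp only [abs_mul, abs_of_pos hr]
  have b1 := abs_smoothTransition_le_one (r * (1 - x) - 1)
  have b2 := abs_smoothTransition_le_one (r * x - 1)
  have g1 := mul_le_of_le_one_right (a := r * |deriv Real.smoothTransition (r * x - 1)| * |a|)
    (by positivity) b1
  have g2 := mul_le_of_le_one_right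
    (a := r * |deriv Real.smoothTransition (r * (1 - x) - 1)| * |a|) (by positivity) b2
  nlinarith

theorem isTest_cutoff_mul {φ : ℝ → ℝ} (hφ : ContDiff ℝ ∞ φ) {r : ℝ} (hr : 0 < r) :
    IsTest fun x => ((cutoff r x * φ x : ℝ) : ℂ) := by
  have hs : tsupport (fun x => ((cutoff r x * φ x : ℝ) : ℂ)) ⊆ tsupport (cutoff r) := by
    refine closure_mono fun x hx => ?_
    rw [Function.mem_support] at hx ⊢
    contrapose! hx
    simp [hx]
  have hs' := hs.trans (tsupport_cutoff_subset hr)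
  refine ⟨Complex.ofRealCLM.contDiff.comp ((contDiff_cutoff r).mul hφ),
    isCompact_Icc.of_isClosed_subset (isClosed_tsupport _) hs', hs'.trans fun x hx => ?_⟩
  have : 0 < 1 / r := by positivity
  exact ⟨by linarith [hx.1], by linarith [hx.2]⟩

theorem integrable_L2 (u : L2) : Integrable u (volume.restrict (Ioo (0 : ℝ) 1)) :=
  (Lp.memLp u).integrable (by norm_num)

/-- Weak derivatives may be tested against smooth functions vanishing at both ends. -/
theorem HasWeakDeriv.integral_mul_deriv {u g : L2} (h : HasWeakDeriv u g) {φ : ℝ → ℝ} {K : ℝ}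
    (hφ : ContDiff ℝ ∞ φ) (hK : 0 ≤ K) (hd : ∀ x, |deriv φ x| ≤ K)
    (h0 : ∀ x ∈ Ioo (0 : ℝ) 1, |φ x| ≤ K * x) (h1 : ∀ x ∈ Ioo (0 : ℝ) 1, |φ x| ≤ K * (1 - x)) :
    ∫ x in Ioo (0 : ℝ) 1, u x * ((deriv φ x : ℝ) : ℂ) = -∫ x in Ioo (0 : ℝ) 1, g x * (φ x : ℂ) := by
  obtain ⟨D, hD0, hD⟩ := exists_abs_deriv_smoothTransition_le
  have hdiff : ∀ x, HasDerivAt φ (deriv φ x) x := fun x =>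
    (hφ.differentiable (by simp) x).hasDerivAt
  have hder : ∀ r x, deriv (fun x => ((cutoff r x * φ x : ℝ) : ℂ)) x =
      ((cutoffDeriv r x * φ x + cutoff r x * deriv φ x : ℝ) : ℂ) := fun r x =>
    (((hasDerivAt_cutoff r x).mul (hdiff x)).ofReal_comp).deriv
  have hr : ∀ j : ℕ, (0 : ℝ) < (j : ℝ) + 1 := fun j => by positivity
  have hev : ∀ x : ℝ, 0 < x → ∀ᶠ j : ℕ in Filter.atTop, 2 < ((j : ℝ) + 1) * x := by
    intro x hx
    have : Filter.Tendsto (fun j : ℕ => ((j : ℝ) + 1) * x) Filter.atTop Filter.atTop :=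
      (Filter.tendsto_atTop_add_const_right _ _ tendsto_natCast_atTop_atTop).atTop_mul_const hx
    exact this.eventually_gt_atTop 2
  have lim1 : Filter.Tendsto (fun j : ℕ => ∫ x in Ioo (0 : ℝ) 1,
      u x * deriv (fun x => ((cutoff (j + 1) x * φ x : ℝ) : ℂ)) x) Filter.atTop
      (nhds (∫ x in Ioo (0 : ℝ) 1, u x * ((deriv φ x : ℝ) : ℂ))) := by
    -- The cutoff derivative is of order `r`, but `φ` vanishes linearly at both ends, so the product
    -- stays below `4 * D * K`; at each fixed `x` it is eventually zero.
    refine tendsto_integral_of_dominated_convergence (fun x => ‖u x‖ * (4 * D * K + K)) ?_ ?_ ?_ ?_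
    · intro j
      refine (integrable_L2 u).aestronglyMeasurable.mul ?_
      exact ((isTest_cutoff_mul hφ (hr j)).1.continuous_deriv (by simp)).aestronglyMeasurable
    · exact (integrable_L2 u).norm.mul_const _
    · intro j
      filter_upwards [ae_restrict_mem measurableSet_Ioo] with x hx
      rw [norm_mul, hder, Complex.norm_real, Real.norm_eq_abs]
      gcongr
      refine (abs_add_le _ _).trans (add_le_add
        (abs_cutoffDeriv_mul_le (hr j) hK hD (h0 x hx) (h1 x hx)) ?_)
      rw [abs_mul]
      exact (mul_le_of_le_one_left (abs_nonneg _) (abs_cutoff_le_one _ _)).trans (hd x)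
    · filter_upwards [ae_restrict_mem measurableSet_Ioo] with x hx
      refine tendsto_const_nhds.congr' ?_
      filter_upwards [hev x hx.1, hev (1 - x) (by linarith [hx.2])] with j a b
      rw [hder, cutoffDeriv_eq_zero a b, cutoff_eq_one a.le b.le]
      simp
  have lim2 : Filter.Tendsto (fun j : ℕ => -∫ x in Ioo (0 : ℝ) 1,
      g x * ((cutoff (j + 1) x * φ x : ℝ) : ℂ)) Filter.atTop
      (nhds (-∫ x in Ioo (0 : ℝ) 1, g x * (φ x : ℂ))) := by
    refine (tendsto_integral_of_dominated_convergence (fun x => ‖g x‖ * K) ?_ ?_ ?_ ?_).neg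
    · intro j
      refine (integrable_L2 g).aestronglyMeasurable.mul ?_
      exact (isTest_cutoff_mul hφ (hr j)).1.continuous.aestronglyMeasurable
    · exact (integrable_L2 g).norm.mul_const _
    · intro j
      filter_upwards [ae_restrict_mem measurableSet_Ioo] with x hx
      rw [norm_mul, Complex.norm_real, Real.norm_eq_abs, abs_mul]
      gcongr
      refine (mul_le_of_le_one_left (abs_nonneg _) (abs_cutoff_le_one _ _)).trans
        ((h0 x hx).trans ?_)
      exact mul_le_of_le_one_right hK hx.2.le
    · filter_upwards [ae_restrict_mem measurableSet_Ioo] with x hx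
      refine tendsto_const_nhds.congr' ?_
      filter_upwards [hev x hx.1, hev (1 - x) (by linarith [hx.2])] with j a b
      rw [cutoff_eq_one a.le b.le, one_mul]
  refine tendsto_nhds_unique lim1 (lim2.congr fun j => ?_)
  exact (h _ (isTest_cutoff_mul hφ (hr j))).symm

/-! ### Fourier coefficients of states and of solutions -/

theorem memLp_ofReal {φ : ℝ → ℝ} (hφ : Continuous φ) (hb : ∀ x, |φ x| ≤ 1) :
    MemLp (fun x => (φ x : ℂ)) 2 (volume.restrict (Ioo (0 : ℝ) 1)) :=
  MemLp.of_bound (Complex.continuous_ofReal.comp hφ).aestronglyMeasurable 1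
    (Filter.Eventually.of_forall fun x => by simpa using hb x)

/-- The functional `f ↦ ∫ f φ` on `L²(0,1)`, for a real function `φ` bounded by `1`. -/
noncomputable def pairing (φ : ℝ → ℝ) (hφ : Continuous φ) (hb : ∀ x, |φ x| ≤ 1) : L2 →L[ℂ] ℂ :=
  innerSL ℂ (memLp_ofReal hφ hb).toLp

theorem pairing_apply {φ : ℝ → ℝ} (hφ : Continuous φ) (hb : ∀ x, |φ x| ≤ 1) (f : L2) :
    pairing φ hφ hb f = ∫ x in Ioo (0 : ℝ) 1, f x * (φ x : ℂ) := by
  rw [pairing, innerSL_apply_apply, L2.inner_def]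
  refine integral_congr_ae ?_
  filter_upwards [(memLp_ofReal hφ hb).coeFn_toLp] with x hx
  rw [hx]
  simp

/-- The sine coefficients of a function in `L²(0,1)`. -/
noncomputable def sinCoef (n : ℤ) : L2 →L[ℂ] ℂ :=
  pairing (fun x => Real.sin (n * Real.pi * x)) (by fun_prop) fun _ => Real.abs_sin_le_one _

/-- The cosine coefficients of a function in `L²(0,1)`. -/
noncomputable def cosCoef (n : ℤ) : L2 →L[ℂ] ℂ :=
  pairing (fun x => Real.cos (n * Real.pi * x)) (by fun_prop) fun _ => Real.abs_cos_le_one _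

theorem sinCoef_apply (n : ℤ) (f : L2) :
    sinCoef n f = ∫ x in Ioo (0 : ℝ) 1, f x * (Real.sin (n * Real.pi * x) : ℂ) :=
  pairing_apply _ _ f

theorem cosCoef_apply (n : ℤ) (f : L2) :
    cosCoef n f = ∫ x in Ioo (0 : ℝ) 1, f x * (Real.cos (n * Real.pi * x) : ℂ) :=
  pairing_apply _ _ f

theorem norm_sinCoef_neg (n : ℤ) (f : L2) : ‖sinCoef (-n) f‖ = ‖sinCoef n f‖ := by
  rw [sinCoef_apply, sinCoef_apply, ← norm_neg, ← integral_neg]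
  simp

theorem cosCoef_neg (n : ℤ) (f : L2) : cosCoef (-n) f = cosCoef n f := by
  rw [cosCoef_apply, cosCoef_apply]
  simp

theorem sinCoef_zero (f : L2) : sinCoef 0 f = 0 := by
  rw [sinCoef_apply]; simp

theorem cosCoef_zero (f : L2) : cosCoef 0 f = ∫ x in Ioo (0 : ℝ) 1, f x := by
  rw [cosCoef_apply]; simp

theorem integral_norm_sq (f : L2) : ∫ x in Ioo (0 : ℝ) 1, ‖f x‖ ^ 2 = ‖f‖ ^ 2 := by
  have h1 : ((‖f‖ ^ 2 : ℝ) : ℂ) = inner ℂ f f := by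
    rw [inner_self_eq_norm_sq_to_K]; simp
  rw [L2.inner_def] at h1
  have h2 : ∀ x, inner ℂ (f x) (f x) = ((‖f x‖ ^ 2 : ℝ) : ℂ) := fun x => by
    rw [inner_self_eq_norm_sq_to_K]; simp
  simp_rw [h2] at h1
  rw [integral_complex_ofReal] at h1
  exact_mod_cast h1.symm

theorem hasSum_norm_sq_sinCoef (f : L2) : HasSum (fun n => ‖sinCoef n f‖ ^ 2) (‖f‖ ^ 2) := by
  simp_rw [sinCoef_apply]
  rw [← integral_norm_sq]
  exact hasSum_sq_sin (Lp.memLp f)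

theorem hasSum_norm_sq_cosCoef (f : L2) : HasSum (fun n => ‖cosCoef n f‖ ^ 2) (‖f‖ ^ 2) := by
  simp_rw [cosCoef_apply]
  rw [← integral_norm_sq]
  exact hasSum_sq_cos (Lp.memLp f)

theorem hasDerivAt_sin_mul (k x : ℝ) :
    HasDerivAt (fun x => Real.sin (k * x)) (k * Real.cos (k * x)) x := by
  have := (Real.hasDerivAt_sin (k * x)).comp x ((hasDerivAt_id x).const_mul k)
  exact this.congr_deriv (by simp; ring)

theorem hasDerivAt_cos_mul (k x : ℝ) :
    HasDerivAt (fun x => Real.cos (k * x)) (-(k * Real.sin (k * x))) x := by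
  have := (Real.hasDerivAt_cos (k * x)).comp x ((hasDerivAt_id x).const_mul k)
  exact this.congr_deriv (by simp; ring)

theorem abs_sin_mul_le (k : ℝ) {x : ℝ} (hx : 0 ≤ x) : |Real.sin (k * x)| ≤ |k| * x := by
  refine Real.abs_sin_le_abs.trans ?_
  rw [abs_mul, abs_of_nonneg hx]

theorem abs_sin_int_mul_pi_mul_le (n : ℤ) {x : ℝ} (hx : x ≤ 1) :
    |Real.sin (n * Real.pi * x)| ≤ |n * Real.pi| * (1 - x) := by
  have h : Real.sin (n * Real.pi * (1 - x)) =
      -(Real.cos (n * Real.pi) * Real.sin (n * Real.pi * x)) := by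
    rw [mul_sub, mul_one, Real.sin_sub, Real.sin_int_mul_pi]
    ring
  have h2 := abs_sin_mul_le (n * Real.pi) (x := 1 - x) (by linarith)
  rwa [h, abs_neg, abs_mul, Real.abs_cos_int_mul_pi, one_mul] at h2

/-- The sine vanishes at both ends, so no boundary condition on `u` is needed. -/
theorem HasWeakDeriv.sinCoef_eq {u g : L2} (h : HasWeakDeriv u g) (n : ℤ) :
    sinCoef n g = -((n * Real.pi : ℝ) : ℂ) * cosCoef n u := by
  have hd : deriv (fun x => Real.sin (n * Real.pi * x)) =
      fun x => n * Real.pi * Real.cos (n * Real.pi * x) :=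
    funext fun x => (hasDerivAt_sin_mul (n * Real.pi) x).deriv
  have e := h.integral_mul_deriv (φ := fun x => Real.sin (n * Real.pi * x)) (K := |n * Real.pi|)
    (by fun_prop) (abs_nonneg _) (fun x => by
      rw [hd, abs_mul]
      exact mul_le_of_le_one_right (abs_nonneg _) (Real.abs_cos_le_one _))
    (fun x hx => abs_sin_mul_le _ hx.1.le) (fun x hx => abs_sin_int_mul_pi_mul_le n hx.2.le)
  rw [hd, ← sinCoef_apply] at e
  rw [cosCoef_apply, neg_mul, ← integral_const_mul, ← neg_eq_iff_eq_neg, ← e]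
  refine integral_congr_ae (Filter.Eventually.of_forall fun x => ?_)
  simp only
  push_cast
  ring

theorem IsTest.integral_deriv_mul_cos {η : ℝ → ℂ} (h : IsTest η) (k : ℝ) :
    ∫ x in Ioo (0 : ℝ) 1, deriv η x * (Real.cos (k * x) : ℂ) =
      k * ∫ x in Ioo (0 : ℝ) 1, η x * (Real.sin (k * x) : ℂ) := by
  have z : ∀ x, x ∉ Ioo (0 : ℝ) 1 → η x = 0 := fun x hx =>
    image_eq_zero_of_notMem_tsupport fun hx' => hx (h.2.2 hx')
  have hc : Continuous (deriv η) := h.1.continuous_deriv (by simp)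
  have key := intervalIntegral.integral_mul_deriv_eq_deriv_mul (a := (0 : ℝ)) (b := 1)
    (u := fun x => (Real.cos (k * x) : ℂ)) (u' := fun x => ((-(k * Real.sin (k * x)) : ℝ) : ℂ))
    (v := η) (v' := deriv η) (fun x _ => (hasDerivAt_cos_mul k x).ofReal_comp)
    (fun x _ => (h.1.differentiable (by simp) x).hasDerivAt)
    (Continuous.intervalIntegrable (by fun_prop) _ _) (hc.intervalIntegrable _ _)
  rw [z 0 (by simp), z 1 (by simp)] at key
  simp only [intervalIntegral.integral_of_le zero_le_one, integral_Ioc_eq_integral_Ioo, mul_zero,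
    sub_self, zero_sub] at key
  rw [← integral_const_mul, ← integral_neg] at *
  calc _ = ∫ x in Ioo (0 : ℝ) 1, (Real.cos (k * x) : ℂ) * deriv η x := by
        simp_rw [mul_comm]
    _ = _ := by
        rw [key]
        refine integral_congr_ae (Filter.Eventually.of_forall fun x => ?_)
        simp only
        push_cast
        ring

/-- The cosine does not vanish at the ends; here the membership in `H¹₀` removes the boundary terms.
Integration by parts proves the identity for test functions, and it is a closed condition on pairs
`(u, u')`. -/
theorem H10.cosCoef_dx (u : H10) (n : ℤ) :
    cosCoef n u.dx = ((n * Real.pi : ℝ) : ℂ) * sinCoef n u.fn := by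
  have hcl : IsClosed {p : WithLp 2 (L2 × L2) |
      cosCoef n p.snd = ((n * Real.pi : ℝ) : ℂ) * sinCoef n p.fst} :=
    isClosed_eq (by fun_prop) (by fun_prop)
  refine closure_minimal (s := (testPairs : Set (WithLp 2 (L2 × L2)))) ?_ hcl u.2
  rintro p ⟨η, hη, h1, h2⟩
  simp only [mem_ofPred_eq]
  rw [cosCoef_apply, sinCoef_apply]
  have e1 : ∫ x in Ioo (0 : ℝ) 1, p.fst x * (Real.sin (n * Real.pi * x) : ℂ) =
      ∫ x in Ioo (0 : ℝ) 1, η x * (Real.sin (n * Real.pi * x) : ℂ) :=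
    integral_congr_ae (h1.mono fun x hx => by simp only [hx])
  have e2 : ∫ x in Ioo (0 : ℝ) 1, p.snd x * (Real.cos (n * Real.pi * x) : ℂ) =
      ∫ x in Ioo (0 : ℝ) 1, deriv η x * (Real.cos (n * Real.pi * x) : ℂ) :=
    integral_congr_ae (h2.mono fun x hx => by simp only [hx])
  rw [e1, e2, hη.integral_deriv_mul_cos]

theorem H10.norm_sq (u : H10) : ‖u‖ ^ 2 = ‖u.fn‖ ^ 2 + ‖u.dx‖ ^ 2 :=
  WithLp.prod_norm_sq_eq_of_L2 _

/-- The Fourier coefficients of a state in the `n`-th mode. -/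
noncomputable def modeOf (n : ℤ) : State →L[ℝ] Mode :=
  let dx : H10 →L[ℂ] L2 := (WithLp.sndL 2 ℂ L2 L2).comp testPairs.topologicalClosure.subtypeL
  let L : State →L[ℂ] Mode :=
    ((cosCoef n).comp dx).prodMap ((sinCoef n).prodMap ((cosCoef n).prodMap (sinCoef n)))
  L.restrictScalars ℝ

theorem modeOf_apply (n : ℤ) (U : State) : modeOf n U =
    (cosCoef n U.1.dx, sinCoef n U.2.1, cosCoef n U.2.2.1, sinCoef n U.2.2.2) := rfl

theorem IsGenerator.modeOf_eq {τ : ℝ} {U Z : State} (h : IsGenerator τ U Z) (n : ℤ) :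
    modeOf n Z = (n * Real.pi : ℝ) • modeOp τ (modeOf n U) := by
  obtain ⟨d₁, w, d₃, q, h1, hw, h3, hq, z1, z2, z3, z4⟩ := h
  rw [modeOf_apply, modeOf_apply, modeOp_apply, z1, z2, z3, z4, ← hw, ← hq, map_sub, map_sub,
    map_smul, H10.cosCoef_dx w, H10.cosCoef_dx q, h1.sinCoef_eq, h3.sinCoef_eq]
  refine Prod.ext ?_ (Prod.ext ?_ (Prod.ext ?_ ?_)) <;> simp <;> ring

theorem IsSolution.modeOf_eq {τ : ℝ} {U : State} {W : ℝ → State} (h : IsSolution τ U W) (n : ℤ)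
    {t : ℝ} (ht : 0 ≤ t) :
    modeOf n (W t) = modeFlow τ (n * Real.pi * t) (modeOf n U) := by
  have hi : ∀ t, 0 ≤ t → modeOf n (W t) - modeOf n U =
      (n * Real.pi : ℝ) • modeOp τ (∫ s in (0 : ℝ)..t, modeOf n (W s)) := by
    intro t ht
    have hW : IntervalIntegrable W volume 0 t := by
      refine ContinuousOn.intervalIntegrable (h.1.mono ?_)
      rw [uIcc_of_le ht]
      exact Icc_subset_Ici_self
    rw [(modeOf n).intervalIntegral_comp_comm hW, ← (h.2 t ht).modeOf_eq, map_sub]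
  -- The initial condition is contained in the integrated equation: at `t = 0` the integral is zero.
  have h0 : modeOf n (W 0) = modeOf n U := by
    have := hi 0 le_rfl
    simpa [sub_eq_zero] using this
  rw [← h0] at hi ⊢
  exact eq_modeFlow_of_integral_eq ((modeOf n).continuous.comp_continuousOn h.1) hi ht

/-! ### Summation over the modes -/

/-- The contribution of the `n`-th mode to `State.normSq`. -/
noncomputable def modeNormSq (n : ℤ) (U : State) : ℝ :=
  ‖sinCoef n U.1.fn‖ ^ 2 + ‖cosCoef n U.1.dx‖ ^ 2 + ‖sinCoef n U.2.1‖ ^ 2 +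
    ‖cosCoef n U.2.2.1‖ ^ 2 + ‖sinCoef n U.2.2.2‖ ^ 2

theorem hasSum_modeNormSq (U : State) : HasSum (fun n => modeNormSq n U) U.normSq := by
  rw [State.normSq, H10.norm_sq]
  exact ((((hasSum_norm_sq_sinCoef _).add (hasSum_norm_sq_cosCoef _)).add
    (hasSum_norm_sq_sinCoef _)).add (hasSum_norm_sq_cosCoef _)).add (hasSum_norm_sq_sinCoef _)

theorem modeNormSq_neg (n : ℤ) (U : State) : modeNormSq (-n) U = modeNormSq n U := by
  simp only [modeNormSq, norm_sinCoef_neg, cosCoef_neg]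

theorem modeNormSq_zero {U : State} (hU : ∫ x in Ioo (0 : ℝ) 1, U.2.2.1 x = 0) :
    modeNormSq 0 U = 0 := by
  have h := U.1.cosCoef_dx 0
  rw [Int.cast_zero, zero_mul, Complex.ofReal_zero, zero_mul] at h
  have h' : cosCoef 0 U.2.2.1 = 0 := by rw [cosCoef_zero, hU]
  simp [modeNormSq, sinCoef_zero, h, h']

/-- Poincaré's inequality mode by mode, with `nπ ≥ 1`, absorbs the coefficient of `φ₁` into that of
`∂ₓφ₁`, whence the `2`; the term `1 / τ` undoes the weight of `φ₃`. -/
theorem modeNormSq_le {τ : ℝ} (hτ : 0 < τ) {n : ℤ} (hn : 0 < n) (U : State) :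
    modeNormSq n U ≤ (2 + 1 / τ) * modeEnergy τ (modeOf n U) := by
  have h1 : ‖sinCoef n U.1.fn‖ ≤ ‖cosCoef n U.1.dx‖ := by
    rw [H10.cosCoef_dx, norm_mul, Complex.norm_real, Real.norm_eq_abs]
    refine le_mul_of_one_le_left (norm_nonneg _) ?_
    have hn' : (1 : ℝ) ≤ n := by exact_mod_cast hn
    have := Real.pi_gt_three
    rw [abs_of_pos (by positivity)]
    nlinarith
  have h2 : ‖sinCoef n U.1.fn‖ ^ 2 ≤ ‖cosCoef n U.1.dx‖ ^ 2 := by gcongr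
  rw [modeNormSq, modeEnergy, modeOf_apply]
  simp only
  have hq : ‖sinCoef n U.2.2.2‖ ^ 2 = (1 / τ) * (τ * ‖sinCoef n U.2.2.2‖ ^ 2) := by
    field_simp
  have hb : 0 ≤ (1 / τ) * (‖cosCoef n U.1.dx‖ ^ 2 + ‖sinCoef n U.2.1‖ ^ 2 +
      ‖cosCoef n U.2.2.1‖ ^ 2) := by positivity
  have hc : 0 ≤ τ * ‖sinCoef n U.2.2.2‖ ^ 2 := by positivity
  nlinarith [sq_nonneg ‖sinCoef n U.2.1‖, sq_nonneg ‖cosCoef n U.2.2.1‖]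

theorem continuousOn_norm_sq_sinCoef {W : ℝ → State} (hW : ContinuousOn W (Ici 0)) (n : ℤ)
    {T : ℝ} (hT : 0 ≤ T) :
    ContinuousOn (fun t => ‖sinCoef n (W t).2.2.2‖ ^ 2) (uIcc 0 T) := by
  rw [uIcc_of_le hT]
  exact (((sinCoef n).continuous.comp_continuousOn
    (hW.mono Icc_subset_Ici_self).snd.snd.snd).norm).pow 2

/-- The contribution of each mode to the initial norm is observed, uniformly in the mode. -/
theorem exists_modeNormSq_le {τ T : ℝ} (hτ : 0 < τ) (hT : 0 < T) :
    ∃ c : ℝ, 0 < c ∧ ∀ U : State, ∫ x in Ioo (0 : ℝ) 1, U.2.2.1 x = 0 →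
      ∀ W : ℝ → State, IsSolution τ U W → ∀ n : ℤ, c * modeNormSq n U ≤
        ∫ t in (0 : ℝ)..T, ‖sinCoef n (W t).2.2.2‖ ^ 2 := by
  obtain ⟨c, hc, h⟩ := exists_modeEnergy_le_integral hτ hT
  have hpos : 0 < 2 + 1 / τ := by positivity
  refine ⟨c / (2 + 1 / τ), by positivity, fun U hU W hW => ?_⟩
  have main : ∀ n : ℕ, 0 < n → c / (2 + 1 / τ) * modeNormSq n U ≤
      ∫ t in (0 : ℝ)..T, ‖sinCoef n (W t).2.2.2‖ ^ 2 := by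
    intro n hn
    have e : ∫ t in (0 : ℝ)..T, ‖sinCoef n (W t).2.2.2‖ ^ 2 =
        ∫ t in (0 : ℝ)..T, ‖(modeFlow τ (n * Real.pi * t) (modeOf n U)).2.2.2‖ ^ 2 := by
      refine intervalIntegral.integral_congr fun t ht => ?_
      rw [uIcc_of_le hT.le] at ht
      have := hW.modeOf_eq n ht.1
      rw [Int.cast_natCast] at this
      rw [← this, modeOf_apply]
    rw [e]
    refine le_trans ?_ (h n hn (modeOf n U))
    rw [div_mul_eq_mul_div, div_le_iff₀ hpos, mul_assoc, mul_comm (modeEnergy _ _)]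
    exact mul_le_mul_of_nonneg_left (modeNormSq_le hτ (by exact_mod_cast hn) U) hc.le
  intro n
  have main' : ∀ m : ℕ, c / (2 + 1 / τ) * modeNormSq m U ≤
      ∫ t in (0 : ℝ)..T, ‖sinCoef m (W t).2.2.2‖ ^ 2 := by
    intro m
    rcases Nat.eq_zero_or_pos m with rfl | hm
    -- For the zero mode both sides vanish; this is where the zero mean of `φ₂` enters.
    · simp [modeNormSq_zero hU, sinCoef_zero]
    · exact main m hm
  obtain ⟨m, rfl | rfl⟩ := n.eq_nat_or_neg
  · exact main' m
  · simpa only [modeNormSq_neg, norm_sinCoef_neg] using main' m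

end Cattaneo

theorem proposition5p1 (τ : ℝ) (hτ : 0 < τ) (hirr : Irrational (Real.sqrt (τ / (1 + τ))))
    (T : ℝ) (hT : 2 < T) :
    ∃ C : ℝ, 0 < C ∧
      ∀ U : Cattaneo.State, (∫ x in Set.Ioo (0 : ℝ) 1, U.2.2.1 x) = 0 →
        ∀ W : ℝ → Cattaneo.State, Cattaneo.IsSolution τ U W →
          C * U.normSq ≤ ∫ t in (0 : ℝ)..T, ∫ x in Set.Ioo (0 : ℝ) 1, ‖(W t).2.2.2 x‖ ^ 2 := by
  have hT0 : 0 < T := by linarith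
  obtain ⟨c, hc, h⟩ := Cattaneo.exists_modeNormSq_le hτ hT0
  refine ⟨c, hc, fun U hU W hW => ?_⟩
  simp_rw [Cattaneo.integral_norm_sq]
  -- It suffices to bound finite partial sums: these commute with the time integral, and on the
  -- observed side only Bessel's inequality at each time is needed.
  refine hasSum_le_of_sum_le ((Cattaneo.hasSum_modeNormSq U).mul_left c) fun s => ?_
  have hi : ∀ n ∈ s, IntervalIntegrable (fun t => ‖Cattaneo.sinCoef n (W t).2.2.2‖ ^ 2)
      volume 0 T := fun n _ =>
    (Cattaneo.continuousOn_norm_sq_sinCoef hW.1 n hT0.le).intervalIntegrable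
  refine (Finset.sum_le_sum fun n _ => h U hU W hW n).trans ?_
  rw [← intervalIntegral.integral_finsetSum hi]
  refine intervalIntegral.integral_mono_on hT0.le (by simpa only [Finset.sum_fn] using IntervalIntegrable.sum s hi) ?_ fun t _ => ?_
  · refine ContinuousOn.intervalIntegrable ?_
    rw [uIcc_of_le hT0.le]
    exact ((hW.1.mono Icc_subset_Ici_self).snd.snd.snd.norm).pow 2
  · exact sum_le_hasSum s (fun _ _ => by positivity)
      (Cattaneo.hasSum_norm_sq_sinCoef (W t).2.2.2)
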